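/- Let $\Omega\subset\mathbb{R}^2$ be a bounded domain (nonempty, open, connected, bounded) with $C^3$ boundary $\Gamma=\partial\Omega$ and outward unit normal vector $\nu$. Let $\kappa>0$ and $c>0$, put $\beta_n=\frac{\kappa^2}{c^2}(n+1)$ for $n=0,1,2,\dots$, and let $\gamma$ be a real number with $\gamma^2=\beta_0$. Let $f_0,f_1,f_2,\dots$ be arbitrary real-valued functions on $\Gamma$. (In the application they are the Laguerre coefficients $f_n(x)=\int_0^\infty e^{-\kappa t}L_n(\kappa t)f(x,t)\,dt$ of the Neumann data $f$ of the wave equation with speed $c$; here $L_n$ is the $n$-th Laguerre polynomial.) Then the sequence of coupled Neumann problems $$\Delta u_n-\gamma^2u_n=\sum_{m=0}^{n-1}\beta_{n-m}u_m\quad\text{in }\Omega,\qquad \frac{\partial u_n}{\partial\nu}=f_n\quad\text{on }\Gamma,\qquad n=0,1,2,\dots,$$ has at most one solution $(u_n)_{n\ge0}$ consisting of real-valued functions $u_n\in C^2(\Omega)\cap C(\overline\Omega)$: if $(u_n)$ and $(v_n)$ are two such solutions, then $u_n=v_n$ on $\overline\Omega$ for every $n\ge0$. Here the normal derivative at $x\in\Gamma$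 is the one-sided derivative from inside $\Omega$, $$\frac{\partial u}{\partial\nu}(x)=\lim_{h\to0+}\frac{u(x)-u(x-h\,\nu(x))}{h}.$$ -/

import Mathlib

open Set Filter Topology Laplacian

/-- The Euclidean plane `ℝ²`. -/
abbrev Plane : Type := EuclideanSpace ℝ (Fin 2)

/-- `ρ` is a local `C³` defining function of the set `Ω` at the point `x`: it is of class `C³` near
`x`, vanishes at `x`, has a nonzero gradient at `x`, and near `x` the set `Ω` is `{ρ < 0}`. -/
structure IsLocalDefiningFunction (Ω : Set Plane) (x : Plane) (ρ : Plane → ℝ) : Prop where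
  contDiffAt : ContDiffAt ℝ 3 ρ x
  zero : ρ x = 0
  gradient_ne_zero : gradient ρ x ≠ 0
  eventually_mem_iff : ∀ᶠ y in 𝓝 x, (y ∈ Ω ↔ ρ y < 0)

/-- A bounded domain in the plane (a nonempty, open, connected, bounded set) whose boundary is
of class `C³`: near every boundary point, the domain lies on one side of a regular `C³` level
curve. -/
structure IsBoundedC3Domain (Ω : Set Plane) : Prop where
  isOpen : IsOpen Ω
  isConnected : IsConnected Ω
  isBounded : Bornology.IsBounded Ω
  boundary : ∀ x ∈ frontier Ω, ∃ ρ : Plane → ℝ, IsLocalDefiningFunction Ω x ρ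

/-- `n` is the outward unit normal vector to the boundary of `Ω` at `x`, that is, the normalized
gradient of a local defining function. -/
def IsOutwardUnitNormal (Ω : Set Plane) (x n : Plane) : Prop :=
  ∃ ρ : Plane → ℝ, IsLocalDefiningFunction Ω x ρ ∧ n = ‖gradient ρ x‖⁻¹ • gradient ρ x

/-- The outward unit normal vector `ν(x)` to the boundary of `Ω`. On a `C³` boundary it exists and
is unique, as proved below. -/
noncomputable def outwardUnitNormal (Ω : Set Plane) (x : Plane) : Plane :=
  Classical.epsilon (IsOutwardUnitNormal Ω x)

theorem outwardUnitNormal_spec {Ω : Set Plane} (hΩ : IsBoundedC3Domain Ω) {x : Plane}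
    (hx : x ∈ frontier Ω) : IsOutwardUnitNormal Ω x (outwardUnitNormal Ω x) := by
  obtain ⟨ρ, hρ⟩ := hΩ.boundary x hx
  exact Classical.epsilon_spec (p := IsOutwardUnitNormal Ω x) ⟨_, ρ, hρ, rfl⟩

theorem IsOutwardUnitNormal.norm_eq_one {Ω : Set Plane} {x n : Plane}
    (h : IsOutwardUnitNormal Ω x n) : ‖n‖ = 1 := by
  obtain ⟨ρ, hρ, rfl⟩ := h
  have := norm_ne_zero_iff.2 hρ.gradient_ne_zero
  rw [norm_smul, norm_inv, norm_norm, inv_mul_cancel₀ this]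

theorem IsLocalDefiningFunction.hasDerivAt_line {Ω : Set Plane} {x : Plane} {ρ : Plane → ℝ}
    (h : IsLocalDefiningFunction Ω x ρ) (w : Plane) :
    HasDerivAt (fun t : ℝ => ρ (x + t • w)) (inner ℝ (gradient ρ x) w) 0 := by
  have h1 : HasFDerivAt ρ (fderiv ℝ ρ x) (x + (0 : ℝ) • w) := by
    simpa using (h.contDiffAt.differentiableAt (by norm_num)).hasFDerivAt
  have h2 : HasDerivAt (fun t : ℝ => x + t • w) w 0 := by
    simpa using ((hasDerivAt_id (0 : ℝ)).smul_const w).const_add x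
  have h3 := h1.comp_hasDerivAt (0 : ℝ) h2
  have h4 : inner ℝ (gradient ρ x) w = fderiv ℝ ρ x w := by
    simp [gradient, InnerProductSpace.toDual_symm_apply]
  rw [h4]
  exact h3

theorem IsOutwardUnitNormal.unique {Ω : Set Plane} {x n n' : Plane}
    (h : IsOutwardUnitNormal Ω x n) (h' : IsOutwardUnitNormal Ω x n') : n = n' := by
  have hn := h.norm_eq_one
  have hn' := h'.norm_eq_one
  by_contra hne
  have hlt : inner ℝ n n' < 1 := (inner_lt_one_iff_real_of_norm_eq_one hn hn').2 hne
  obtain ⟨ρ, hρ, hnρ⟩ := h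
  obtain ⟨σ, hσ, hnσ⟩ := h'
  have key : ∀ τ m, IsLocalDefiningFunction Ω x τ → m = ‖gradient τ x‖⁻¹ • gradient τ x →
      ∀ w, inner ℝ (gradient τ x) w = ‖gradient τ x‖ * inner ℝ m w := by
    intro τ m hτ hm w
    have := norm_ne_zero_iff.2 hτ.gradient_ne_zero
    rw [hm, real_inner_smul_left, ← mul_assoc, mul_inv_cancel₀ this, one_mul]
  have hpos1 := norm_pos_iff.2 hρ.gradient_ne_zero
  have hpos2 := norm_pos_iff.2 hσ.gradient_ne_zero
  have d1 := hρ.hasDerivAt_line (n' - n)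
  have d2 := hσ.hasDerivAt_line (n' - n)
  rw [key ρ n hρ hnρ, inner_sub_right, real_inner_self_eq_norm_sq, hn] at d1
  rw [key σ n' hσ hnσ, inner_sub_right, real_inner_self_eq_norm_sq, hn',
    real_inner_comm] at d2
  have s1 : ‖gradient ρ x‖ * (inner ℝ n n' - 1 ^ 2) < 0 :=
    mul_neg_of_pos_of_neg hpos1 (by linarith)
  have s2 : 0 < ‖gradient σ x‖ * (1 ^ 2 - inner ℝ n n') := mul_pos hpos2 (by linarith)
  have c : Tendsto (fun t : ℝ => x + t • (n' - n)) (𝓝[>] 0) (𝓝 x) := by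
    have : Continuous (fun t : ℝ => x + t • (n' - n)) := by fun_prop
    have h0 := this.tendsto 0
    simp only [zero_smul, add_zero] at h0
    exact h0.mono_left nhdsWithin_le_nhds
  have e1 := (hasDerivAt_iff_tendsto_slope.1 d1).eventually (gt_mem_nhds s1)
  have e2 := (hasDerivAt_iff_tendsto_slope.1 d2).eventually (lt_mem_nhds s2)
  have le : 𝓝[>] (0 : ℝ) ≤ 𝓝[≠] 0 := nhdsWithin_mono _ fun t ht => ne_of_gt ht
  obtain ⟨t, ht1, ht2, ht3, ht4, ht⟩ := ((e1.filter_mono le).and ((e2.filter_mono le).and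
    ((c.eventually hρ.eventually_mem_iff).and ((c.eventually hσ.eventually_mem_iff).and
      self_mem_nhdsWithin)))).exists
  have ht : 0 < t := ht
  simp only [slope_def_field, zero_smul, add_zero, hρ.zero, hσ.zero, sub_zero]
    at ht1 ht2
  have a1 : ρ (x + t • (n' - n)) < 0 := by
    by_contra hcon
    exact absurd ht1 (not_lt.2 (div_nonneg (not_lt.1 hcon) ht.le))
  have a2 : σ (x + t • (n' - n)) < 0 := ht4.1 (ht3.2 a1)
  exact absurd ht2 (not_lt.2 (div_nonpos_of_nonpos_of_nonneg a2.le ht.le))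

/-- `∂u/∂ν (x) = a`: the derivative at the boundary point `x` of `u` in the direction of the outward
unit normal, taken from inside the domain, that is,
`a = lim (u (x - h ν(x)) - u x) / (-h)` as `h → 0+`. -/
def HasNormalDerivAt (Ω : Set Plane) (u : Plane → ℝ) (a : ℝ) (x : Plane) : Prop :=
  HasDerivWithinAt (fun t : ℝ => u (x + t • outwardUnitNormal Ω x)) a (Iic 0) 0

/-- The coefficients `βₙ = (κ² / c²) (n + 1)`. -/
noncomputable def laguerreBeta (κ c : ℝ) (n : ℕ) : ℝ :=
  κ ^ 2 / c ^ 2 * ((n : ℝ) + 1)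

/-- The sequence `u₀, u₁, …` of functions in `C²(Ω) ∩ C(closure Ω)` solves the coupled problems
`Δ uₙ - γ² uₙ = ∑_{m < n} β_{n-m} uₘ` in `Ω`, `∂uₙ/∂ν = fₙ` on the boundary, `n = 0, 1, …`.
Only the values of `uₙ` on the closure of `Ω` and of `fₙ` on the boundary matter. -/
structure IsNeumannSequenceSolution (Ω : Set Plane) (κ c γ : ℝ) (f u : ℕ → Plane → ℝ) :
    Prop where
  contDiffOn : ∀ n, ContDiffOn ℝ 2 (u n) Ω
  continuousOn : ∀ n, ContinuousOn (u n) (closure Ω)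
  equation : ∀ n, ∀ x ∈ Ω,
    Δ (u n) x - γ ^ 2 * u n x = ∑ m ∈ Finset.range n, laguerreBeta κ c (n - m) * u m x
  boundary_condition : ∀ n, ∀ x ∈ frontier Ω, HasNormalDerivAt Ω (u n) (f n x) x

/-!
The difference `w = uₙ - vₙ` of two solutions satisfies, once the functions of lower index agree,
`Δ w = γ² w` in `Ω` with vanishing normal derivative, and `γ² > 0`. So it is enough that such a `w`
is nonpositive (`nonpos_of_laplacian_eq_mul_of_hasNormalDerivAt_zero`); the same for `-w` then
gives `w = 0`.

Suppose the maximum `M` of `w` over the closure of `Ω` is positive. It is not attained in `Ω`, as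
there `Δ w ≤ 0` at a maximum point (`IsLocalMax.laplacian_nonpos`). If it is attained at a boundary
point `x`, then `∂w/∂ν (x) > 0`, a form of Hopf's lemma (`HasNormalDerivAt.pos_of_isMaxOn`). The
barrier used for it is `ψ = -ρ - K |· - x|²`, where `ρ` is a local defining function of `Ω` at `x`:
it vanishes at `x`, decreases at `x` in the direction of the outward normal, and for `K` large
enough it is nonpositive on the boundary of the intersection of `Ω` with a small ball about `x`.
For small `ε > 0` the function `w + ε ψ` cannot exceed `M` in this intersection, since at an
interior maximum point with a value above `M` one would have
`0 ≥ Δ (w + ε ψ) = γ² w + ε Δ ψ ≥ γ² (M - ε ψ) + ε Δ ψ > 0`. So `w + ε ψ` is maximal at `x`, its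
normal derivative at `x` is nonnegative, and `∂w/∂ν (x) ≥ -ε ∂ψ/∂ν (x) > 0`. Because the
zeroth-order term is strictly positive and `ε` is free, `ψ` need not be subharmonic, and no
interior ball is needed.
-/

/-! ### The Laplacian at a local maximum -/

/-- The second derivative test: a positive second derivative at a critical point gives a local
minimum, so at a local maximum the function would be locally constant. -/
theorem IsLocalMax.deriv_deriv_nonpos {g : ℝ → ℝ} {a : ℝ} (h : IsLocalMax g a)
    (hc : ContinuousAt g a) : deriv (deriv g) a ≤ 0 := by
  by_contra! hpos
  have hmin := isLocalMin_of_deriv_deriv_pos hpos h.deriv_eq_zero hc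
  have heq : g =ᶠ[𝓝 a] fun _ => g a := by
    filter_upwards [h, hmin] with t h1 h2 using le_antisymm h1 h2
  have h0 : deriv (deriv g) a = 0 := by
    rw [heq.deriv.deriv_eq]
    simp
  exact hpos.ne' h0

theorem ContDiffAt.deriv_deriv_line {E : Type*} [NormedAddCommGroup E] [NormedSpace ℝ E]
    {f : E → ℝ} {x : E} (hf : ContDiffAt ℝ 2 f x) (e : E) :
    deriv (deriv fun t : ℝ => f (x + t • e)) 0 = iteratedFDeriv ℝ 2 f x ![e, e] := by
  have hline : ∀ t : ℝ, HasDerivAt (fun t : ℝ => x + t • e) e t := fun t => by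
    simpa using ((hasDerivAt_id t).smul_const e).const_add x
  have hcont : Tendsto (fun t : ℝ => x + t • e) (𝓝 0) (𝓝 x) := by
    simpa using (hline 0).continuousAt.tendsto
  have hderiv : (deriv fun t : ℝ => f (x + t • e)) =ᶠ[𝓝 0] fun t => fderiv ℝ f (x + t • e) e := by
    filter_upwards [hcont.eventually (hf.eventually (by simp))] with t ht
    have hd : HasFDerivAt f (fderiv ℝ f (x + t • e)) (x + t • e) :=
      (ht.differentiableAt (by norm_num)).hasFDerivAt
    exact HasDerivAt.deriv (hd.comp_hasDerivAt t (hline t))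
  have hd : HasFDerivAt (fderiv ℝ f) (fderiv ℝ (fderiv ℝ f) x) (x + (0 : ℝ) • e) := by
    rw [zero_smul, add_zero]
    exact ((hf.fderiv_right (m := 1) (by norm_num)).differentiableAt (by norm_num)).hasFDerivAt
  have h1 : HasDerivAt (fun t : ℝ => fderiv ℝ f (x + t • e)) (fderiv ℝ (fderiv ℝ f) x e) 0 :=
    hd.comp_hasDerivAt (0 : ℝ) (hline 0)
  have h2 : HasDerivAt (fun t : ℝ => fderiv ℝ f (x + t • e) e) (fderiv ℝ (fderiv ℝ f) x e e) 0 := by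
    simpa using h1.clm_apply (hasDerivAt_const (0 : ℝ) e)
  rw [hderiv.deriv_eq, iteratedFDeriv_two_apply, h2.deriv]
  rfl

theorem IsLocalMax.laplacian_nonpos {f : Plane → ℝ} {x : Plane} (h : IsLocalMax f x)
    (hf : ContDiffAt ℝ 2 f x) : Δ f x ≤ 0 := by
  rw [InnerProductSpace.laplacian_eq_iteratedFDeriv_stdOrthonormalBasis]
  refine Finset.sum_nonpos fun i _ => ?_
  set e := stdOrthonormalBasis ℝ Plane i
  rw [← hf.deriv_deriv_line e]
  have hcont : ContinuousAt (fun t : ℝ => x + t • e) 0 := by fun_prop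
  have h' : IsLocalMax f (x + (0 : ℝ) • e) := by simpa using h
  have hf' : ContinuousAt f (x + (0 : ℝ) • e) := by simpa using hf.continuousAt
  exact IsLocalMax.deriv_deriv_nonpos (g := fun t : ℝ => f (x + t • e))
    (IsLocalMax.comp_continuous (g := fun t : ℝ => x + t • e) h' hcont)
    (ContinuousAt.comp (f := fun t : ℝ => x + t • e) hf' hcont)

theorem ContDiffAt.continuousAt_laplacian {f : Plane → ℝ} {x : Plane} (hf : ContDiffAt ℝ 2 f x) :
    ContinuousAt (Δ f) x := by
  rw [InnerProductSpace.laplacian_eq_iteratedFDeriv_stdOrthonormalBasis]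
  have h : ContinuousAt (iteratedFDeriv ℝ 2 f) x :=
    (hf.iteratedFDeriv_right (m := 0) (by norm_num)).continuousAt
  refine tendsto_finsetSum _ fun i _ => ?_
  exact (ContinuousMultilinearMap.apply ℝ (fun _ : Fin 2 => Plane) ℝ _).continuous.continuousAt.comp
    h

/-! ### The barrier at a boundary point -/

theorem HasNormalDerivAt.sub {Ω : Set Plane} {u v : Plane → ℝ} {a b : ℝ} {x : Plane}
    (hu : HasNormalDerivAt Ω u a x) (hv : HasNormalDerivAt Ω v b x) :
    HasNormalDerivAt Ω (u - v) (a - b) x :=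
  HasDerivWithinAt.sub hu hv

theorem HasNormalDerivAt.add_const_smul {Ω : Set Plane} {u v : Plane → ℝ} {a b : ℝ} {x : Plane}
    (hu : HasNormalDerivAt Ω u a x) (ε : ℝ) (hv : HasNormalDerivAt Ω v b x) :
    HasNormalDerivAt Ω (u + ε • v) (a + ε * b) x :=
  HasDerivWithinAt.add hu (HasDerivWithinAt.const_mul ε hv)

theorem tendsto_add_smul_nhdsLT_zero (x n : Plane) :
    Tendsto (fun t : ℝ => x + t • n) (𝓝[<] 0) (𝓝 x) := by
  have h : Continuous (fun t : ℝ => x + t • n) := by fun_prop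
  have h0 := h.tendsto 0
  simp only [zero_smul, add_zero] at h0
  exact h0.mono_left nhdsWithin_le_nhds

theorem IsOutwardUnitNormal.exists_hasDerivAt {Ω : Set Plane} {x n : Plane}
    (h : IsOutwardUnitNormal Ω x n) : ∃ ρ : Plane → ℝ, IsLocalDefiningFunction Ω x ρ ∧
      ∃ b > 0, HasDerivAt (fun t : ℝ => ρ (x + t • n)) b 0 := by
  obtain ⟨ρ, hρ, hn⟩ := h
  have hpos : 0 < ‖gradient ρ x‖ := norm_pos_iff.2 hρ.gradient_ne_zero
  refine ⟨ρ, hρ, ‖gradient ρ x‖, hpos, ?_⟩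
  have hd := hρ.hasDerivAt_line n
  have hb : inner ℝ (gradient ρ x) n = ‖gradient ρ x‖ := by
    rw [hn, real_inner_smul_right, real_inner_self_eq_norm_sq]
    field_simp
  rwa [hb] at hd

theorem IsOutwardUnitNormal.eventually_mem {Ω : Set Plane} {x n : Plane}
    (h : IsOutwardUnitNormal Ω x n) : ∀ᶠ t in 𝓝[<] (0 : ℝ), x + t • n ∈ Ω := by
  obtain ⟨ρ, hρ, b, hb, hd⟩ := h.exists_hasDerivAt
  have hle : 𝓝[<] (0 : ℝ) ≤ 𝓝[≠] 0 := nhdsWithin_mono _ fun t ht => ne_of_lt ht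
  filter_upwards [((hasDerivAt_iff_tendsto_slope.1 hd).eventually (lt_mem_nhds hb)).filter_mono hle,
    (tendsto_add_smul_nhdsLT_zero x n).eventually hρ.eventually_mem_iff, self_mem_nhdsWithin]
    with t h1 h2 ht
  have ht : t < 0 := ht
  simp only [slope_def_field, zero_smul, add_zero, hρ.zero, sub_zero] at h1
  refine h2.2 ?_
  by_contra hcon
  exact absurd h1 (not_lt.2 (div_nonpos_of_nonneg_of_nonpos (not_lt.1 hcon) ht.le))

/-- Existence of a barrier at a boundary point: a `C²` function near `x` that vanishes at `x`, has
a negative outward normal derivative there, and is nonpositive on the boundary of the intersection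
of `Ω` with a small ball. -/
theorem IsBoundedC3Domain.exists_barrier {Ω : Set Plane} (hΩ : IsBoundedC3Domain Ω) {x : Plane}
    (hx : x ∈ frontier Ω) : ∃ δ > 0, ∃ ψ : Plane → ℝ, ψ x = 0 ∧
      (∀ y ∈ Metric.closedBall x δ, ContDiffAt ℝ 2 ψ y) ∧
      (∀ y ∈ Metric.closedBall x δ, y ∈ Ω → dist y x < δ ∨ ψ y ≤ 0) ∧
      (∀ y ∈ Metric.closedBall x δ, y ∉ Ω → ψ y ≤ 0) ∧
      ∃ b > 0, HasNormalDerivAt Ω ψ (-b) x := by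
  obtain ⟨ρ, hρ, b, hb, hd⟩ := (outwardUnitNormal_spec hΩ hx).exists_hasDerivAt
  obtain ⟨δ, hδ, hball⟩ := Metric.nhds_basis_closedBall.eventually_iff.1
    ((hρ.contDiffAt.eventually (by simp)).and hρ.eventually_mem_iff)
  have hsm : ∀ y ∈ Metric.closedBall x δ, ContDiffAt ℝ 2 ρ y := fun y hy =>
    (hball hy).1.of_le (by norm_num)
  obtain ⟨C, hC⟩ := (isCompact_closedBall x δ).exists_bound_of_continuousOn
    (f := ρ) fun y hy => (hsm y hy).continuousAt.continuousWithinAt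
  have hC0 : 0 ≤ C := (norm_nonneg _).trans (hC x (Metric.mem_closedBall_self hδ.le))
  -- On the sphere, the quadratic term equals `-C`, and `-ρ ≤ C`.
  refine ⟨δ, hδ, fun y => -ρ y - C / δ ^ 2 * ‖y - x‖ ^ 2, by simp [hρ.zero], fun y hy => ?_,
    fun y hy _ => ?_, fun y hy hyΩ => ?_, b, hb, ?_⟩
  · exact (hsm y hy).neg.sub
      (contDiffAt_const.mul ((contDiff_id.sub contDiff_const).norm_sq ℝ).contDiffAt)
  · rcases lt_or_eq_of_le (Metric.mem_closedBall.1 hy) with h | h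
    · exact Or.inl h
    · right
      simp only [← dist_eq_norm]
      rw [h, div_mul_cancel₀ _ (by positivity)]
      have := (abs_le.1 (hC y hy)).1
      linarith
  · have h1 : 0 ≤ ρ y := not_lt.1 fun h => hyΩ ((hball hy).2.2 h)
    have h2 : 0 ≤ C / δ ^ 2 * ‖y - x‖ ^ 2 := by positivity
    linarith
  · have hq : HasDerivAt (fun t : ℝ => C / δ ^ 2 * ‖x + t • outwardUnitNormal Ω x - x‖ ^ 2) 0 0 := by
      have h := ((hasDerivAt_id (0 : ℝ)).pow 2).const_mul (C / δ ^ 2)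
      simpa [norm_smul, (outwardUnitNormal_spec hΩ hx).norm_eq_one] using h
    have h := (hd.neg.sub hq).hasDerivWithinAt (s := Iic 0)
    rwa [sub_zero] at h

/-! ### Hopf's lemma and the maximum principle -/

theorem HasNormalDerivAt.nonneg_of_eventually_le {Ω : Set Plane} {u : Plane → ℝ} {a : ℝ}
    {x : Plane} (h : HasNormalDerivAt Ω u a x)
    (hle : ∀ᶠ t in 𝓝[<] (0 : ℝ), u (x + t • outwardUnitNormal Ω x) ≤ u x) : 0 ≤ a := by
  have hs := hasDerivWithinAt_iff_tendsto_slope.1 h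
  rw [Iic_sdiff_right] at hs
  refine ge_of_tendsto hs ?_
  filter_upwards [hle, self_mem_nhdsWithin] with t h1 ht
  have ht : t < 0 := ht
  rw [slope_def_field]
  simp only [zero_smul, add_zero, sub_zero]
  exact div_nonneg_of_nonpos (by linarith) ht.le

/-- Hopf's lemma for solutions of `Δ w = μ w` with `μ > 0`: at a boundary point where `w` attains
a positive maximum, the outward normal derivative is positive. -/
theorem HasNormalDerivAt.pos_of_isMaxOn {Ω : Set Plane} (hΩ : IsBoundedC3Domain Ω) {μ : ℝ}
    (hμ : 0 < μ) {w : Plane → ℝ} (hw : ContDiffOn ℝ 2 w Ω) (hwc : ContinuousOn w (closure Ω))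
    (heq : ∀ y ∈ Ω, Δ w y = μ * w y) {x : Plane} (hx : x ∈ frontier Ω)
    (hmax : IsMaxOn w (closure Ω) x) (hpos : 0 < w x) {a : ℝ} (ha : HasNormalDerivAt Ω w a x) :
    0 < a := by
  obtain ⟨δ, hδ, ψ, hψx, hψ, hψin, hψout, b, hb, hψd⟩ := hΩ.exists_barrier hx
  have hψc : ContinuousOn ψ (Metric.closedBall x δ) := fun y hy =>
    (hψ y hy).continuousAt.continuousWithinAt
  obtain ⟨A, hA⟩ := (isCompact_closedBall x δ).exists_bound_of_continuousOn
    (f := fun y => Δ ψ y - μ * ψ y) fun y hy =>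
      ((hψ y hy).continuousAt_laplacian.sub
        (continuousAt_const.mul (hψ y hy).continuousAt)).continuousWithinAt
  have hA0 : 0 ≤ A := (norm_nonneg _).trans (hA x (Metric.mem_closedBall_self hδ.le))
  -- `ε` is so small that `ε |Δ ψ - μ ψ| < μ w x`.
  obtain ⟨ε, hε, hεA⟩ : ∃ ε > 0, ε * A < μ * w x := by
    have hp : 0 < μ * w x := mul_pos hμ hpos
    refine ⟨μ * w x / (A + 1), by positivity, ?_⟩
    rw [div_mul_eq_mul_div, div_lt_iff₀ (by positivity)]
    nlinarith
  have hxcl : x ∈ closure Ω := frontier_subset_closure hx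
  have hxK : x ∈ closure Ω ∩ Metric.closedBall x δ := ⟨hxcl, Metric.mem_closedBall_self hδ.le⟩
  have hK : IsCompact (closure Ω ∩ Metric.closedBall x δ) :=
    (isCompact_closedBall x δ).inter_left isClosed_closure
  obtain ⟨z, hz, hzmax⟩ := hK.exists_isMaxOn ⟨x, hxK⟩ (f := w + ε • ψ)
    ((hwc.mono inter_subset_left).add ((hψc.mono inter_subset_right).const_smul ε))
  have hzle : (w + ε • ψ) z ≤ w x := by
    have hwz : w z ≤ w x := hmax hz.1
    have hnonpos : ψ z ≤ 0 → (w + ε • ψ) z ≤ w x := fun h => by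
      have := mul_nonpos_of_nonneg_of_nonpos hε.le h
      simp only [Pi.add_apply, Pi.smul_apply, smul_eq_mul]
      linarith
    by_cases hzΩ : z ∈ Ω
    · rcases hψin z hz.2 hzΩ with hzd | h
      · by_contra! hlt
        have hnhds : closure Ω ∩ Metric.closedBall x δ ∈ 𝓝 z :=
          inter_mem (mem_of_superset (hΩ.isOpen.mem_nhds hzΩ) subset_closure)
            (Metric.closedBall_mem_nhds_of_mem hzd)
        have hw2 : ContDiffAt ℝ 2 w z := hw.contDiffAt (hΩ.isOpen.mem_nhds hzΩ)
        have hψ2 : ContDiffAt ℝ 2 (ε • ψ) z := (hψ z hz.2).const_smul ε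
        have hΔ := (hzmax.isLocalMax hnhds).laplacian_nonpos (hw2.add hψ2)
        rw [hw2.laplacian_add hψ2, InnerProductSpace.laplacian_smul ε (hψ z hz.2), heq z hzΩ]
          at hΔ
        simp only [Pi.add_apply, Pi.smul_apply, smul_eq_mul] at hΔ hlt
        have h1 := mul_le_mul_of_nonneg_left (abs_le.1 (hA z hz.2)).1 hε.le
        have h2 := mul_lt_mul_of_pos_left hlt hμ
        linarith
      · exact hnonpos h
    · exact hnonpos (hψout z hz.2 hzΩ)
  have hd := (ha.add_const_smul ε hψd).nonneg_of_eventually_le (by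
    filter_upwards [(outwardUnitNormal_spec hΩ hx).eventually_mem,
      (tendsto_add_smul_nhdsLT_zero x (outwardUnitNormal Ω x)).eventually
        (Metric.closedBall_mem_nhds x hδ)] with t h1 h2
    have h3 : (w + ε • ψ) (x + t • outwardUnitNormal Ω x) ≤ (w + ε • ψ) z :=
      hzmax ⟨subset_closure h1, h2⟩
    have h4 : (w + ε • ψ) x = w x := by simp [hψx]
    linarith)
  have := mul_pos hε hb
  linarith

/-- The maximum principle for the homogeneous Neumann problem of `Δ w = μ w` with `μ > 0`. -/
theorem nonpos_of_laplacian_eq_mul_of_hasNormalDerivAt_zero {Ω : Set Plane}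
    (hΩ : IsBoundedC3Domain Ω) {μ : ℝ} (hμ : 0 < μ) {w : Plane → ℝ} (hw : ContDiffOn ℝ 2 w Ω)
    (hwc : ContinuousOn w (closure Ω)) (heq : ∀ y ∈ Ω, Δ w y = μ * w y)
    (hN : ∀ x ∈ frontier Ω, HasNormalDerivAt Ω w 0 x) {y : Plane} (hy : y ∈ closure Ω) :
    w y ≤ 0 := by
  obtain ⟨x, hx, hmax⟩ := hΩ.isBounded.isCompact_closure.exists_isMaxOn ⟨y, hy⟩ hwc
  refine (hmax hy : w y ≤ w x).trans ?_
  by_contra! hpos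
  by_cases hxΩ : x ∈ Ω
  · have hΔ := (hmax.isLocalMax (mem_of_superset (hΩ.isOpen.mem_nhds hxΩ)
      subset_closure)).laplacian_nonpos (hw.contDiffAt (hΩ.isOpen.mem_nhds hxΩ))
    rw [heq x hxΩ] at hΔ
    exact absurd (mul_pos hμ hpos) (not_lt.2 hΔ)
  · have hxf : x ∈ frontier Ω := by
      rw [hΩ.isOpen.frontier_eq]
      exact ⟨hx, hxΩ⟩
    exact lt_irrefl _
      (HasNormalDerivAt.pos_of_isMaxOn hΩ hμ hw hwc heq hxf hmax hpos (hN x hxf))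

/-! ### Uniqueness for the coupled problems -/

/-- One half of the induction step for uniqueness, stated so that it can be used with `u` and `v`
exchanged. -/
theorem IsNeumannSequenceSolution.le_of_forall_lt_eqOn {Ω : Set Plane} (hΩ : IsBoundedC3Domain Ω)
    {κ c γ : ℝ} (hγ : 0 < γ ^ 2) {f u v : ℕ → Plane → ℝ}
    (hu : IsNeumannSequenceSolution Ω κ c γ f u) (hv : IsNeumannSequenceSolution Ω κ c γ f v)
    {n : ℕ} (h : ∀ m < n, EqOn (u m) (v m) (closure Ω)) {x : Plane} (hx : x ∈ closure Ω) :
    u n x ≤ v n x := by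
  have hN : ∀ y ∈ frontier Ω, HasNormalDerivAt Ω (u n - v n) 0 y := fun y hy => by
    simpa using (hu.boundary_condition n y hy).sub (hv.boundary_condition n y hy)
  refine sub_nonpos.1 (nonpos_of_laplacian_eq_mul_of_hasNormalDerivAt_zero hΩ hγ
    ((hu.contDiffOn n).sub (hv.contDiffOn n)) ((hu.continuousOn n).sub (hv.continuousOn n))
    (fun y hy => ?_) hN hx)
  have hyn := hΩ.isOpen.mem_nhds hy
  change Δ (u n - v n) y = γ ^ 2 * (u n y - v n y)
  rw [((hu.contDiffOn n).contDiffAt hyn).laplacian_sub ((hv.contDiffOn n).contDiffAt hyn)]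
  have hsum : ∑ m ∈ Finset.range n, laguerreBeta κ c (n - m) * u m y =
      ∑ m ∈ Finset.range n, laguerreBeta κ c (n - m) * v m y :=
    Finset.sum_congr rfl fun m hm => by rw [h m (Finset.mem_range.1 hm) (subset_closure hy)]
  linarith [hu.equation n y hy, hv.equation n y hy]

theorem mainTheorem1 (Ω : Set Plane) (hΩ : IsBoundedC3Domain Ω)
    (κ c γ : ℝ) (hκ : 0 < κ) (hc : 0 < c) (hγ : γ ^ 2 = laguerreBeta κ c 0)
    (f u v : ℕ → Plane → ℝ)
    (hu : IsNeumannSequenceSolution Ω κ c γ f u)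
    (hv : IsNeumannSequenceSolution Ω κ c γ f v) :
    ∀ n, EqOn (u n) (v n) (closure Ω) := by
  have hγ0 : 0 < γ ^ 2 := by
    rw [hγ, laguerreBeta]
    positivity
  intro n
  induction n using Nat.strong_induction_on with
  | _ n ih =>
    intro x hx
    exact le_antisymm (hu.le_of_forall_lt_eqOn hΩ hγ0 hv ih hx)
      (hv.le_of_forall_lt_eqOn hΩ hγ0 hu (fun m hm => (ih m hm).symm) hx)
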